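/- A sequence $X=(x_j)_{j\in\mathbb{Z}}$ of real numbers is called scattered if $\inf\{|s-t| : s,t\in X,\ s\neq t\}>0$ and $\lim_{j\to\pm\infty}x_j=\pm\infty$. Let $\varphi(x)=x^{-1}\ln(1+x^2)$ for $x\neq 0$ and $\varphi(0)=0$ (the continuous extension), and let \[ S(\varphi,X)=\Big\{x\mapsto\sum_{j=1}^{n}a_j\,\varphi(x-t_j)\ :\ n\in\mathbb{N},\ a_j\in\mathbb{R},\ t_j\in X\Big\}. \] Proposition. Let $X$ be any scattered sequence and let $a,b\in\mathbb{R}$ with $a\le b$. Then $S(\varphi,X)$ is uniformly dense in $C[a,b]$: for every continuous $f:[a,b]\to\mathbb{R}$ and every $\varepsilon>0$ there is $s\in S(\varphi,X)$ such that \[ \sup_{x\in[a,b]}|f(x)-s(x)|<\varepsilon . \] -/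

import Mathlib

/-- A set of reals `A` is `δ`-separated: the infimum of the distances between two distinct points
of `A` equals `δ`, and `δ > 0`. -/
def IsDeltaSeparated (A : Set ℝ) (δ : ℝ) : Prop :=
  0 < δ ∧ IsGLB {d : ℝ | ∃ s ∈ A, ∃ t ∈ A, s ≠ t ∧ d = |s - t|} δ

/-- A bi-infinite real sequence is scattered if (its set of values) is `δ`-separated for some
`δ > 0` and it tends to `±∞` as the index tends to `±∞`. -/
def IsScattered (X : ℤ → ℝ) : Prop :=
  (∃ δ : ℝ, IsDeltaSeparated (Set.range X) δ) ∧
    Filter.Tendsto X Filter.atTop Filter.atTop ∧ Filter.Tendsto X Filter.atBot Filter.atBot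

/-- The approximation set `S(φ, X)`: all functions `x ↦ ∑_{j=1}^{n} a_j φ(x - x_j)` with `n ≥ 1`,
`a_j` real and `x_j` in `X`. -/
def approxSet (φ : ℝ → ℝ) (X : ℤ → ℝ) : Set (ℝ → ℝ) :=
  {s | ∃ n : ℕ, 0 < n ∧ ∃ a : Fin n → ℝ, ∃ t : Fin n → ℝ, (∀ j, t j ∈ Set.range X) ∧
    s = fun x => ∑ j, a j * φ (x - t j)}

/-- The kernel `φ(x) = x⁻¹ ln(1 + x²)`. At `x = 0` this formula evaluates to `0`, which is the
limit of `φ` there, so this is the continuous extension of `φ` to the whole line. -/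
noncomputable def logKernel (x : ℝ) : ℝ := x⁻¹ * Real.log (1 + x ^ 2)

/-!
Let `M` be the closure in `C[a, b]` of the restrictions of `S(φ, X)`. By Weierstrass it suffices
that every monomial `x ^ k` lies in `M`, which is shown by strong induction on `k`. Only the
translates by `t = X j → +∞` are used. With `u = 1 / t`,
`φ(x - t) = -u * (1 - x u)⁻¹ * (2 log t + 2 Re log (1 - (x + i) u))`.
Expanding in powers of `u`, the coefficient of `u ^ (n + 1)` is `-(2 log t * x ^ n + q n x)`, where
`q n` is a polynomial in `x` of degree at most `n`. The part of order at most `u ^ k` is therefore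
a polynomial of degree less than `k`, which lies in `M` by the induction hypothesis. Subtracting it
and multiplying by `-t ^ (k + 1) / (2 log t)` leaves `x ^ k + O(1 / t) + O(1 / log t)`, uniformly
for `x` in `[a, b]`: the logarithm makes the monomial dominate the unwanted term `q k`. This
estimate is `abs_scaled_logKernel_sub_le`; that the subtracted polynomial lies in `M` follows from
`lowerPart_mem`.
-/

open Filter Topology

/-! ### The kernel -/

theorem continuous_logKernel : Continuous logKernel := by
  rw [continuous_iff_continuousAt]
  intro x
  rcases eq_or_ne x 0 with rfl | hx
  · -- At the origin `|φ x| ≤ |x|`, because `log (1 + x ^ 2) ≤ x ^ 2`.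
    have h : ∀ x : ℝ, ‖logKernel x‖ ≤ |x| := by
      intro x
      have h0 : 0 ≤ Real.log (1 + x ^ 2) := Real.log_nonneg (by nlinarith [sq_nonneg x])
      have h1 : Real.log (1 + x ^ 2) ≤ x ^ 2 := by
        have := Real.log_le_sub_one_of_pos (show 0 < 1 + x ^ 2 by positivity)
        linarith
      rw [logKernel, norm_mul, norm_inv, Real.norm_eq_abs, Real.norm_eq_abs, abs_of_nonneg h0]
      rcases eq_or_ne x 0 with rfl | hx
      · simp
      · have hx' : 0 < |x| := abs_pos.mpr hx
        rw [inv_mul_le_iff₀ hx', ← sq, sq_abs]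
        exact h1
    have h0 : logKernel 0 = 0 := by simp [logKernel]
    rw [ContinuousAt, h0]
    refine squeeze_zero_norm h ?_
    simpa using (continuous_abs.tendsto (0 : ℝ))
  · have h1 : (1 : ℝ) + x ^ 2 ≠ 0 := by positivity
    unfold logKernel
    exact (continuousAt_inv₀ hx).mul (ContinuousAt.log (by fun_prop) h1)

/-! ### Expansion of a translate in powers of `1 / t` -/

/-- The Taylor polynomial of `log ((1 - x u) ^ 2 + u ^ 2)` in the variable `u`, up to order
`u ^ (n - 1)`. -/
noncomputable def logQuadTaylor (n : ℕ) (u x : ℝ) : ℝ :=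
  2 * (Complex.logTaylor n (-((x + Complex.I) * u))).re

theorem norm_neg_add_I_mul_le {B x u : ℝ} (hx : |x| + 1 ≤ B) (hu : 0 ≤ u) :
    ‖-(((x : ℂ) + Complex.I) * u)‖ ≤ B * u := by
  rw [norm_neg, norm_mul, Complex.norm_real, Real.norm_of_nonneg hu]
  gcongr
  refine (norm_add_le _ _).trans ?_
  simpa using hx

theorem log_quad_eq (u x : ℝ) :
    Real.log ((1 - x * u) ^ 2 + u ^ 2) =
      2 * (Complex.log (1 + -(((x : ℂ) + Complex.I) * u))).re := by
  rw [Complex.log_re]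
  have h : ‖1 + -(((x : ℂ) + Complex.I) * u)‖ ^ 2 = (1 - x * u) ^ 2 + u ^ 2 := by
    rw [← Complex.normSq_eq_norm_sq, Complex.normSq_apply]
    simp
    ring
  rw [← h, Real.log_pow]
  norm_num

theorem abs_log_quad_sub_taylor_le {B x u : ℝ} (hx : |x| + 1 ≤ B) (hu : 0 ≤ u)
    (hBu : B * u ≤ 1 / 2) {n : ℕ} (hn : n ≠ 0) :
    |Real.log ((1 - x * u) ^ 2 + u ^ 2) - logQuadTaylor n u x| ≤ 4 * (B * u) ^ n := by
  obtain ⟨n, rfl⟩ := Nat.exists_eq_succ_of_ne_zero hn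
  have hz := norm_neg_add_I_mul_le hx hu
  rw [log_quad_eq, logQuadTaylor]
  set z : ℂ := -(((x : ℂ) + Complex.I) * u)
  have hz2 : ‖z‖ ≤ 1 / 2 := hz.trans hBu
  have h := Complex.norm_log_sub_logTaylor_le n (show ‖z‖ < 1 by linarith)
  have h2 : (1 - ‖z‖)⁻¹ ≤ 2 := by
    rw [inv_le_comm₀ (by linarith) (by norm_num)]
    linarith
  have h3 : ‖z‖ ^ (n + 1) * (1 - ‖z‖)⁻¹ / (n + 1) ≤ (B * u) ^ (n + 1) * 2 := by
    have h4 : (0 : ℝ) ≤ (1 - ‖z‖)⁻¹ := inv_nonneg.mpr (by linarith)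
    have h5 : 0 ≤ B * u := (norm_nonneg z).trans hz
    refine (div_le_self (by positivity) (by linarith [n.cast_nonneg (α := ℝ)])).trans ?_
    gcongr
  have h5 := (Complex.abs_re_le_norm _).trans (h.trans h3)
  rw [← mul_sub, ← Complex.sub_re, abs_mul, abs_two]
  calc _ ≤ 2 * ((B * u) ^ (n + 1) * 2) := by gcongr
    _ = _ := by rw [Nat.succ_eq_add_one]; ring

theorem inv_one_sub_eq_geom_sum_add {w : ℝ} (hw : w ≠ 1) (n : ℕ) :
    (1 - w)⁻¹ = ∑ i ∈ Finset.range n, w ^ i + w ^ n * (1 - w)⁻¹ := by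
  have : 1 - w ≠ 0 := sub_ne_zero.mpr hw.symm
  have h := geom_sum_mul_neg w n
  field_simp
  linarith

/-- Each power `(x u) ^ i` of the geometric series is paired with the logarithm expanded to order
`k - i`, so that the approximating sum is a polynomial in `x` of degree less than `k`. -/
theorem abs_inv_mul_log_quad_sub_le {B x u : ℝ} (hx : |x| + 1 ≤ B) (hu : 0 ≤ u)
    (hBu : B * u ≤ 1 / 2) (k : ℕ) :
    |(1 - x * u)⁻¹ * Real.log ((1 - x * u) ^ 2 + u ^ 2) -
        ∑ i ∈ Finset.range k, (x * u) ^ i * logQuadTaylor (k - i) u x| ≤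
      4 * (k + 1) * (B * u) ^ k := by
  have hw : |x * u| ≤ B * u := by
    rw [abs_mul, abs_of_nonneg hu]
    gcongr
    linarith
  have hB : 0 ≤ B * u := (abs_nonneg _).trans hw
  have hw1 : x * u ≤ 1 / 2 := (le_abs_self _).trans (hw.trans hBu)
  have hinv : |(1 - x * u)⁻¹| ≤ 2 := by
    rw [abs_of_nonneg (inv_nonneg.mpr (by linarith)), inv_le_comm₀ (by linarith) (by norm_num)]
    linarith
  set L := Real.log ((1 - x * u) ^ 2 + u ^ 2) with hL
  have hLb : |L| ≤ 2 := by
    have h := abs_log_quad_sub_taylor_le hx hu hBu one_ne_zero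
    rw [← hL] at h
    simp [logQuadTaylor, Complex.logTaylor] at h
    linarith
  rw [inv_one_sub_eq_geom_sum_add (show x * u ≠ 1 by linarith) k, add_mul, Finset.sum_mul,
    add_sub_right_comm, ← Finset.sum_sub_distrib]
  refine (abs_add_le _ _).trans ?_
  have h1 : |∑ i ∈ Finset.range k, ((x * u) ^ i * L - (x * u) ^ i * logQuadTaylor (k - i) u x)| ≤
      ∑ _i ∈ Finset.range k, 4 * (B * u) ^ k := by
    refine (Finset.abs_sum_le_sum_abs _ _).trans (Finset.sum_le_sum fun i hi => ?_)
    have hi' := Finset.mem_range.mp hi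
    rw [← mul_sub, abs_mul, abs_pow]
    calc _ ≤ (B * u) ^ i * (4 * (B * u) ^ (k - i)) := by
          gcongr
          exact abs_log_quad_sub_taylor_le hx hu hBu (by omega)
      _ = 4 * ((B * u) ^ i * (B * u) ^ (k - i)) := by ring
      _ = _ := by rw [← pow_add, Nat.add_sub_cancel' hi'.le]
  have h2 : |(x * u) ^ k * (1 - x * u)⁻¹ * L| ≤ (B * u) ^ k * 2 * 2 := by
    rw [abs_mul, abs_mul, abs_pow]
    gcongr
  rw [Finset.sum_const, Finset.card_range, nsmul_eq_mul] at h1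
  linarith

theorem abs_inv_sub_geom_sum_le {B x u : ℝ} (hx : |x| + 1 ≤ B) (hu : 0 ≤ u)
    (hBu : B * u ≤ 1 / 2) (k : ℕ) :
    |(1 - x * u)⁻¹ - ∑ i ∈ Finset.range k, (x * u) ^ i| ≤ 2 * (B * u) ^ k := by
  have hw : |x * u| ≤ B * u := by
    rw [abs_mul, abs_of_nonneg hu]
    gcongr
    linarith
  have hB : 0 ≤ B * u := (abs_nonneg _).trans hw
  have hw1 : x * u ≤ 1 / 2 := (le_abs_self _).trans (hw.trans hBu)
  have hinv : |(1 - x * u)⁻¹| ≤ 2 := by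
    rw [abs_of_nonneg (inv_nonneg.mpr (by linarith)), inv_le_comm₀ (by linarith) (by norm_num)]
    linarith
  rw [inv_one_sub_eq_geom_sum_add (show x * u ≠ 1 by linarith) k, add_sub_cancel_left, abs_mul,
    abs_pow, mul_comm]
  gcongr

/-- At `x = t` both sides are `0` by the convention `0⁻¹ = 0`. -/
theorem logKernel_sub_eq {x t : ℝ} (ht : 0 < t) :
    logKernel (x - t) =
      -(t⁻¹ * (1 - x * t⁻¹)⁻¹ * (2 * Real.log t + Real.log ((1 - x * t⁻¹) ^ 2 + t⁻¹ ^ 2))) := by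
  have h1 : 1 + (x - t) ^ 2 = t ^ 2 * ((1 - x * t⁻¹) ^ 2 + t⁻¹ ^ 2) := by
    field_simp
    ring
  have h2 : (1 - x * t⁻¹) ^ 2 + t⁻¹ ^ 2 ≠ 0 := by positivity
  have h3 : t⁻¹ * (1 - x * t⁻¹)⁻¹ = -(x - t)⁻¹ := by
    rw [← mul_inv, ← inv_neg]
    congr 1
    field_simp
    ring
  rw [logKernel, h1, Real.log_mul (by positivity) h2, Real.log_pow, h3]
  push_cast
  ring

/-- The polynomial in `x`, of degree less than `k`, that has to be subtracted from
`-t ^ (k + 1) / (2 log t) * φ (x - t)` in order to leave `x ^ k` up to a vanishing error. -/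
noncomputable def lowerPart (k : ℕ) (t x : ℝ) : ℝ :=
  t ^ k * ∑ i ∈ Finset.range k, (x * t⁻¹) ^ i +
    t ^ k / (2 * Real.log t) *
      ∑ i ∈ Finset.range k, (x * t⁻¹) ^ i * logQuadTaylor (k - i) t⁻¹ x

theorem abs_scaled_logKernel_sub_le {B x t : ℝ} (hx : |x| + 1 ≤ B) (ht : 2 * B ≤ t)
    (k : ℕ) :
    |-(t ^ (k + 1) / (2 * Real.log t)) * logKernel (x - t) - lowerPart k t x - x ^ k| ≤
      2 * B ^ (k + 1) * t⁻¹ + 2 * (k + 1) * B ^ k * (Real.log t)⁻¹ := by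
  have hB : 1 ≤ B := by linarith [abs_nonneg x]
  have ht0 : 0 < t := by linarith
  have hlog : 0 < Real.log t := Real.log_pos (by linarith)
  have hu : 0 ≤ t⁻¹ := by positivity
  have hBu : B * t⁻¹ ≤ 1 / 2 := by
    rw [← div_eq_mul_inv, div_le_iff₀ ht0]
    linarith
  have hA := abs_inv_sub_geom_sum_le hx hu hBu (k + 1)
  have hC := abs_inv_mul_log_quad_sub_le hx hu hBu k
  rw [logKernel_sub_eq ht0, lowerPart]
  rw [Finset.sum_range_succ] at hA
  set v := (1 - x * t⁻¹)⁻¹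
  set L := Real.log ((1 - x * t⁻¹) ^ 2 + t⁻¹ ^ 2)
  set G := ∑ i ∈ Finset.range k, (x * t⁻¹) ^ i
  set Q := ∑ i ∈ Finset.range k, (x * t⁻¹) ^ i * logQuadTaylor (k - i) t⁻¹ x
  have e : -(t ^ (k + 1) / (2 * Real.log t)) * -(t⁻¹ * v * (2 * Real.log t + L)) -
      (t ^ k * G + t ^ k / (2 * Real.log t) * Q) - x ^ k =
      t ^ k * (v - (G + (x * t⁻¹) ^ k)) + t ^ k / (2 * Real.log t) * (v * L - Q) := by
    rw [mul_pow, inv_pow, pow_succ]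
    field_simp
    ring
  rw [e]
  refine (abs_add_le _ _).trans ?_
  rw [abs_mul, abs_mul, abs_of_pos (show 0 < t ^ k by positivity),
    abs_of_pos (show 0 < t ^ k / (2 * Real.log t) by positivity)]
  calc _ ≤ t ^ k * (2 * (B * t⁻¹) ^ (k + 1)) +
        t ^ k / (2 * Real.log t) * (4 * (k + 1) * (B * t⁻¹) ^ k) := by gcongr
    _ = _ := by
      rw [mul_pow, mul_pow, inv_pow, inv_pow, pow_succ t]
      field_simp
      ring

/-! ### The subtracted polynomial has degree less than `k` -/

/-- Functions on the line that agree on `[a, b]` with an element of the subspace `M` of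
`C[a, b]`. -/
def restrictMem {a b : ℝ} (M : Submodule ℝ C(Set.Icc a b, ℝ)) : Submodule ℝ (ℝ → ℝ) where
  carrier := {g | ∃ m ∈ M, ∀ x : Set.Icc a b, m x = g x}
  zero_mem' := ⟨0, M.zero_mem, fun _ => rfl⟩
  add_mem' := by
    rintro g h ⟨m, hm, hg⟩ ⟨n, hn, hh⟩
    exact ⟨m + n, M.add_mem hm hn, fun x => by simp [hg, hh]⟩
  smul_mem' := by
    rintro c g ⟨m, hm, hg⟩
    exact ⟨c • m, M.smul_mem c hm, fun x => by simp [hg]⟩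

theorem pow_mul_re_add_I_pow_mem {W : Submodule ℝ (ℝ → ℝ)} {k : ℕ}
    (hW : ∀ i < k, (fun x : ℝ => x ^ i) ∈ W) {i j : ℕ} (hij : i + j < k) :
    (fun x : ℝ => x ^ i * (((x : ℂ) + Complex.I) ^ j).re) ∈ W := by
  have e : (fun x : ℝ => x ^ i * (((x : ℂ) + Complex.I) ^ j).re) =
      ∑ m ∈ Finset.range (j + 1),
        ((Complex.I ^ (j - m)).re * (j.choose m : ℝ)) • fun x : ℝ => x ^ (i + m) := by
    funext x
    rw [add_pow, Complex.re_sum, Finset.mul_sum, Finset.sum_apply]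
    refine Finset.sum_congr rfl fun m _ => ?_
    have : ((x : ℂ) ^ m * Complex.I ^ (j - m) * (j.choose m : ℂ)).re =
        x ^ m * (Complex.I ^ (j - m)).re * j.choose m := by
      rw [← Complex.ofReal_pow, ← Complex.ofReal_natCast, Complex.re_mul_ofReal,
        Complex.re_ofReal_mul]
    rw [this, Pi.smul_apply, smul_eq_mul, pow_add]
    ring
  rw [e]
  refine W.sum_mem fun m hm => W.smul_mem _ (hW _ ?_)
  have := Finset.mem_range.mp hm
  omega

theorem lowerPart_mem {W : Submodule ℝ (ℝ → ℝ)} {k : ℕ}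
    (hW : ∀ i < k, (fun x : ℝ => x ^ i) ∈ W) (t : ℝ) : lowerPart k t ∈ W := by
  have e : lowerPart k t =
      t ^ k • ∑ i ∈ Finset.range k, (t⁻¹ ^ i) • (fun x : ℝ => x ^ i) +
      (t ^ k / (2 * Real.log t)) • ∑ i ∈ Finset.range k, ∑ j ∈ Finset.range (k - i),
        (t⁻¹ ^ i * (2 * ((-1) ^ (j + 1) * (-t⁻¹) ^ j / j))) •
          fun x : ℝ => x ^ i * (((x : ℂ) + Complex.I) ^ j).re := by
    funext x
    simp only [lowerPart, Pi.add_apply, Pi.smul_apply, Finset.sum_apply, smul_eq_mul]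
    congr 2
    · exact Finset.sum_congr rfl fun i _ => by rw [mul_pow, mul_comm]
    · refine Finset.sum_congr rfl fun i _ => ?_
      rw [logQuadTaylor, Complex.logTaylor, Complex.re_sum, Finset.mul_sum, Finset.mul_sum]
      refine Finset.sum_congr rfl fun j _ => ?_
      have : ((-1 : ℂ) ^ (j + 1) * (-(((x : ℂ) + Complex.I) * (t⁻¹ : ℝ))) ^ j / j) =
          (((-1) ^ (j + 1) * (-t⁻¹) ^ j / j : ℝ) : ℂ) * ((x : ℂ) + Complex.I) ^ j := by
        push_cast
        rw [← mul_neg, mul_pow]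
        ring
      rw [this, Complex.re_ofReal_mul, mul_pow]
      ring
  rw [e]
  refine W.add_mem (W.smul_mem _ (W.sum_mem fun i hi => W.smul_mem _ (hW i ?_)))
    (W.smul_mem _ (W.sum_mem fun i hi => W.sum_mem fun j hj => W.smul_mem _
      (pow_mul_re_add_I_pow_mem hW ?_)))
  · exact Finset.mem_range.mp hi
  · have := Finset.mem_range.mp hj
    omega

/-! ### Density -/

/-- A closed subspace containing the translates `φ(· - t)` for arbitrarily large `t` contains all
monomials. -/
theorem pow_mem_restrictMem {a b : ℝ} {M : Submodule ℝ C(Set.Icc a b, ℝ)}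
    (hM : IsClosed (M : Set C(Set.Icc a b, ℝ))) {X : ℤ → ℝ} (hX : Tendsto X atTop atTop)
    (h : ∀ j, (fun x => logKernel (x - X j)) ∈ restrictMem M) (k : ℕ) :
    (fun x : ℝ => x ^ k) ∈ restrictMem M := by
  induction k using Nat.strong_induction_on with
  | _ k ih =>
  set B : ℝ := max |a| |b| + 1 with hB
  have hmem : ∀ j, (fun x => -(X j ^ (k + 1) / (2 * Real.log (X j))) * logKernel (x - X j) -
      lowerPart k (X j) x) ∈ restrictMem M := fun j =>
    (restrictMem M).sub_mem ((restrictMem M).smul_mem _ (h j)) (lowerPart_mem ih _)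
  choose m hmM hm using hmem
  refine ⟨⟨fun x => (x : ℝ) ^ k, by fun_prop⟩, ?_, fun x => rfl⟩
  refine hM.mem_of_tendsto (f := m) (b := atTop) ?_ (Eventually.of_forall hmM)
  have hlim : Tendsto (fun j => 2 * B ^ (k + 1) * (X j)⁻¹ +
      2 * (k + 1) * B ^ k * (Real.log (X j))⁻¹) atTop (𝓝 0) := by
    have h1 := (tendsto_inv_atTop_zero.comp hX).const_mul (2 * B ^ (k + 1))
    have h2 := (tendsto_inv_atTop_zero.comp (Real.tendsto_log_atTop.comp hX)).const_mul
      (2 * (k + 1) * B ^ k)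
    simpa using h1.add h2
  rw [tendsto_iff_norm_sub_tendsto_zero]
  refine squeeze_zero' (Eventually.of_forall fun j => norm_nonneg _) ?_ hlim
  filter_upwards [hX.eventually_ge_atTop (2 * B)] with j hj
  have hB0 : 1 ≤ B := by linarith [abs_nonneg a, le_max_left |a| |b|]
  have hlog : 0 ≤ Real.log (X j) := Real.log_nonneg (by linarith)
  have hXj : 0 ≤ X j := by linarith
  rw [ContinuousMap.norm_le _ (by positivity)]
  intro x
  have hx : |(x : ℝ)| + 1 ≤ B := by
    have := abs_le_max_abs_abs x.2.1 x.2.2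
    linarith
  simpa [hm, Real.norm_eq_abs] using abs_scaled_logKernel_sub_le hx hj k

/-- The continuous functions on the line lying in `S(φ, X)`, as a subspace. -/
def approxSubmodule (φ : ℝ → ℝ) (X : ℤ → ℝ) : Submodule ℝ C(ℝ, ℝ) where
  carrier := {s | (s : ℝ → ℝ) ∈ approxSet φ X}
  zero_mem' := ⟨1, one_pos, 0, fun _ => X 0, fun _ => ⟨0, rfl⟩, by ext; simp⟩
  add_mem' := by
    rintro f g ⟨n, hn, c, t, ht, hf⟩ ⟨p, _, d, s, hs, hg⟩
    refine ⟨n + p, by omega, Fin.append c d, Fin.append t s, fun j => ?_, ?_⟩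
    · refine Fin.addCases (fun i => ?_) (fun i => ?_) j
      · simpa using ht i
      · simpa using hs i
    · ext x
      simp [Fin.sum_univ_add, hf, hg]
  smul_mem' := by
    rintro r f ⟨n, hn, c, t, ht, hf⟩
    refine ⟨n, hn, r • c, t, ht, ?_⟩
    ext x
    simp [hf, Finset.mul_sum, mul_assoc]

/-- The restrictions of `S(φ, X)` to `[a, b]`. -/
def restrictedApprox (φ : ℝ → ℝ) (X : ℤ → ℝ) (a b : ℝ) : Submodule ℝ C(Set.Icc a b, ℝ) :=
  (approxSubmodule φ X).map
    (ContinuousMap.compRightAlgHom ℝ ℝ (ContinuousMap.restrict (Set.Icc a b)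
      (ContinuousMap.id ℝ))).toLinearMap

theorem translate_mem_restrictMem (X : ℤ → ℝ) (a b : ℝ) (j : ℤ) :
    (fun x => logKernel (x - X j)) ∈
      restrictMem (restrictedApprox logKernel X a b).topologicalClosure := by
  let s : C(ℝ, ℝ) := ⟨fun x => logKernel (x - X j), continuous_logKernel.comp (by fun_prop)⟩
  refine ⟨s.restrict (Set.Icc a b), Submodule.le_topologicalClosure _ ⟨s, ?_, rfl⟩, fun x => rfl⟩
  exact ⟨1, one_pos, fun _ => 1, fun _ => X j, fun _ => ⟨j, rfl⟩, by ext; simp [s]⟩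

theorem restrictedApprox_topologicalClosure {X : ℤ → ℝ} (hX : Tendsto X atTop atTop) (a b : ℝ) :
    (restrictedApprox logKernel X a b).topologicalClosure = ⊤ := by
  set M := (restrictedApprox logKernel X a b).topologicalClosure
  have hclosed : IsClosed (M : Set C(Set.Icc a b, ℝ)) :=
    Submodule.isClosed_topologicalClosure _
  have hpow := pow_mem_restrictMem hclosed hX (translate_mem_restrictMem X a b)
  have hpoly : (polynomialFunctions (Set.Icc a b) : Set C(Set.Icc a b, ℝ)) ⊆ M := by
    rintro _ ⟨p, -, rfl⟩
    have : (fun x : ℝ => p.eval x) ∈ restrictMem M := by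
      have e : (fun x : ℝ => p.eval x) =
          ∑ i ∈ Finset.range (p.natDegree + 1), p.coeff i • fun x : ℝ => x ^ i := by
        funext x
        simp [Polynomial.eval_eq_sum_range]
      rw [e]
      exact Submodule.sum_mem _ fun i _ => Submodule.smul_mem _ _ (hpow i)
    obtain ⟨m, hm, hmp⟩ := this
    have hpm : Polynomial.toContinuousMapOn p (Set.Icc a b) = m := by
      ext x
      simp [hmp]
    change Polynomial.toContinuousMapOn p (Set.Icc a b) ∈ M
    rwa [hpm]
  rw [eq_top_iff]
  intro f _
  have hf : f ∈ (polynomialFunctions (Set.Icc a b)).topologicalClosure := by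
    rw [polynomialFunctions_closure_eq_top]
    trivial
  exact closure_minimal hpoly hclosed hf

theorem mainTheorem5 (X : ℤ → ℝ) (hX : IsScattered X) (a b : ℝ)
    (f : C(Set.Icc a b, ℝ)) (ε : ℝ) (hε : 0 < ε) :
    ∃ s : C(ℝ, ℝ), (s : ℝ → ℝ) ∈ approxSet logKernel X ∧
      ‖f - s.restrict (Set.Icc a b)‖ < ε := by
  have hf : f ∈ (restrictedApprox logKernel X a b).topologicalClosure := by
    rw [restrictedApprox_topologicalClosure hX.2.1]
    trivial
  obtain ⟨_, ⟨s, hs, rfl⟩, hd⟩ := Metric.mem_closure_iff.mp hf ε hε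
  rw [dist_eq_norm] at hd
  exact ⟨s, hs, hd⟩
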